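/- Let $b \ge 2$ be a fixed base and $A_b=\{0,1,\dots,b-1\}$. A complete deterministic automaton $\mathcal B=(Q',A_b,\eta,j,S)$ is a \emph{quotient} of a complete deterministic automaton $\mathcal A=(Q,A_b,\delta,i,T)$ if there is a surjective map $\varphi\colon Q\to Q'$ with $\varphi(i)=j$, $\varphi(\delta(q,a))=\eta(\varphi(q),a)$ for all $q\in Q$, $a\in A_b$, and $q\in T\iff\varphi(q)\in S$ for all $q \in Q$. For $p\ge 1$ coprime to $b$ and $R\subseteq\{0,\dots,p-1\}$ such that $p$ is the smallest period of the periodic set $\{n\in\mathbb N : n \bmod p\in R\}$, the \emph{Pascal automaton} $\mathcal P_{R,p}$ has the state set $\mathbb Z/p\mathbb Z\times\mathbb Z/\psi\mathbb Z$, where $\psi$ is the multiplicative order of $b$ modulo $p$, the initial state $(0,0)$, the final states $R\times\mathbb Z/\psi\mathbb Z$, and the transitions $(s,t)\cdot a=(s+a\,b^{t},\,t+1)$ for $a\in A_b$. A complete DFA is \emph{minimal} if all its states are accessible and distinct states have distinct future languages. Theorem. It is decidable in linear time whether a minimal complete DFA $\mathcal A$ over $A_b$ is a quotient of a Pascal automaton.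 Precisely: for every $b\ge 2$ there are a program of a unit-cost random access machine (with the arithmetic operations addition and truncated subtraction, comparison, and indirect loads and stores) and a constant $C$ such that, for every $n$ and every minimal complete DFA $\mathcal A$ over $A_b$ with state set $\{0,\dots,n-1\}$, given by $n$, its initial state, its transition table and its list of final flags, the program halts after at most $C\,n$ steps, using throughout only numbers and addresses at most $C\,n$ (words of $\log_2 n+O(1)$ bits), with output $1$ if there are $R,p$ such that $\mathcal A$ is a quotient of the Pascal automaton $\mathcal P_{R,p}$, and with output $0$ otherwise. -/

import Mathlib

/-! ### Complete deterministic automata: coverings, quotients, minimality -/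

/-- `φ` is a covering from the complete automaton `A` onto the complete automaton `B`: it maps the
initial state to the initial state, commutes with the transitions, and the final states of `A` are
exactly the states lying over the final states of `B`. -/
structure IsCovering {α σ τ : Type*} (A : DFA α σ) (B : DFA α τ) (φ : σ → τ) : Prop where
  surjective : Function.Surjective φ
  map_start : φ A.start = B.start
  map_step : ∀ q a, φ (A.step q a) = B.step (φ q) a
  mem_accept_iff : ∀ q, q ∈ A.accept ↔ φ q ∈ B.accept

/-- `B` is a quotient of `A`. -/
def IsQuotientOf {α σ τ : Type*} (B : DFA α τ) (A : DFA α σ) : Prop :=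
  ∃ φ : σ → τ, IsCovering A B φ

/-- A complete DFA is minimal if every state is accessible from the initial state and distinct
states have distinct future languages. -/
structure IsMinimalDFA {α σ : Type*} (A : DFA α σ) : Prop where
  accessible : ∀ q, ∃ w : List α, A.eval w = q
  reduced : ∀ q q', A.acceptsFrom q = A.acceptsFrom q' → q = q'

/-! ### Periodic sets of numbers and Pascal automata -/

/-- The set of all natural numbers congruent modulo `q` to an element of `S`. -/
def periodicSet (S : Set ℕ) (q : ℕ) : Set ℕ :=
  {n | ∃ r ∈ S, n ≡ r [MOD q]}

/-- `E` is periodic of (positive) period `q`. -/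
def IsPeriodOf (E : Set ℕ) (q : ℕ) : Prop :=
  0 < q ∧ ∃ S : Set ℕ, (∀ r ∈ S, r < q) ∧ E = periodicSet S q

/-- `p` is the smallest period, and `R` the set of residues, of a periodic set of numbers. -/
def IsCanonicalPair (R : Set ℕ) (p : ℕ) : Prop :=
  (∀ r ∈ R, r < p) ∧ IsLeast {q | IsPeriodOf (periodicSet R p) q} p

/-- The automaton with state set `ℤ/pℤ × ℤ/ψℤ`, where `ψ` is the order of `b` modulo `p`. It reads
base `b` numerals, least significant digit first: after a word `u` its state is
`(value of u mod p, length of u mod ψ)`. -/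
noncomputable def pascalAutomaton (b p : ℕ) (R : Set ℕ) :
    DFA (Fin b) (ZMod p × ZMod (orderOf (b : ZMod p))) where
  step q a := (q.1 + ((a : ℕ) : ZMod p) * (b : ZMod p) ^ q.2.val, q.2 + 1)
  start := (0, 0)
  accept := {q | ∃ r ∈ R, (r : ZMod p) = q.1}

/-- `A` is a quotient of a Pascal automaton in base `b`, with period coprime to `b` and canonical
parameters. -/
def IsPascalQuotient {b : ℕ} {σ : Type*} (A : DFA (Fin b) σ) : Prop :=
  ∃ (p : ℕ) (R : Set ℕ), p.Coprime b ∧ IsCanonicalPair R p ∧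
    IsQuotientOf A (pascalAutomaton b p R)

/-! ### Random access machines with bounded words and unit cost -/

/-- The store of a random access machine: registers, and a memory addressed by numbers. A program
mentions only finitely many registers. -/
structure Store where
  reg : ℕ → ℕ
  mem : ℕ → ℕ

/-- `σ.setReg x v` is `σ` with `v` written into register `x`. -/
def Store.setReg (σ : Store) (x v : ℕ) : Store :=
  { σ with reg := Function.update σ.reg x v }

/-- `σ.setMem i v` is `σ` with `v` written into the memory cell with address `i`. -/
def Store.setMem (σ : Store) (i v : ℕ) : Store :=
  { σ with mem := Function.update σ.mem i v }

/-- Programs of a random access machine, with structured control. The arguments `x y z` are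
names of registers. -/
inductive Program where
  /-- do nothing -/
  | skip : Program
  /-- `x := c` -/
  | const (x c : ℕ) : Program
  /-- `x := y` -/
  | copy (x y : ℕ) : Program
  /-- `x := y + z` -/
  | add (x y z : ℕ) : Program
  /-- `x := y - z`, truncated at `0` -/
  | sub (x y z : ℕ) : Program
  /-- `x := mem[y]` -/
  | load (x y : ℕ) : Program
  /-- `mem[x] := y` -/
  | store (x y : ℕ) : Program
  /-- first `P`, then `Q` -/
  | seq (P Q : Program) : Program
  /-- if `x < y` then `P` else `Q` -/
  | ifLt (x y : ℕ) (P Q : Program) : Program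
  /-- while `x < y` do `P` -/
  | whileLt (x y : ℕ) (P : Program) : Program

/-- `Exec W P σ t σ'`: on a machine whose words hold the numbers `0, …, W`, the program `P`, started
in the store `σ`, halts in the store `σ'` after exactly `t` steps. Each elementary instruction and
each evaluation of a test is one step. There is no execution in which a constant or a sum exceeds
`W`, so in a run from a store with entries at most `W` all numbers and all addresses that are used
stay at most `W`. -/
inductive Exec (W : ℕ) : Program → Store → ℕ → Store → Prop
  | skip (σ : Store) : Exec W .skip σ 1 σ
  | const (σ : Store) (x c : ℕ) (h : c ≤ W) : Exec W (.const x c) σ 1 (σ.setReg x c)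
  | copy (σ : Store) (x y : ℕ) : Exec W (.copy x y) σ 1 (σ.setReg x (σ.reg y))
  | add (σ : Store) (x y z : ℕ) (h : σ.reg y + σ.reg z ≤ W) :
      Exec W (.add x y z) σ 1 (σ.setReg x (σ.reg y + σ.reg z))
  | sub (σ : Store) (x y z : ℕ) : Exec W (.sub x y z) σ 1 (σ.setReg x (σ.reg y - σ.reg z))
  | load (σ : Store) (x y : ℕ) : Exec W (.load x y) σ 1 (σ.setReg x (σ.mem (σ.reg y)))
  | store (σ : Store) (x y : ℕ) : Exec W (.store x y) σ 1 (σ.setMem (σ.reg x) (σ.reg y))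
  | seq {P Q : Program} {σ₀ σ₁ σ₂ : Store} {t₁ t₂ : ℕ}
      (h₁ : Exec W P σ₀ t₁ σ₁) (h₂ : Exec W Q σ₁ t₂ σ₂) : Exec W (.seq P Q) σ₀ (t₁ + t₂) σ₂
  | ifLt_true {x y : ℕ} {P Q : Program} {σ σ' : Store} {t : ℕ}
      (h : σ.reg x < σ.reg y) (h₁ : Exec W P σ t σ') : Exec W (.ifLt x y P Q) σ (t + 1) σ'
  | ifLt_false {x y : ℕ} {P Q : Program} {σ σ' : Store} {t : ℕ}
      (h : ¬ σ.reg x < σ.reg y) (h₁ : Exec W Q σ t σ') : Exec W (.ifLt x y P Q) σ (t + 1) σ'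
  | while_true {x y : ℕ} {P : Program} {σ₀ σ₁ σ₂ : Store} {t₁ t₂ : ℕ}
      (h : σ₀.reg x < σ₀.reg y) (h₁ : Exec W P σ₀ t₁ σ₁)
      (h₂ : Exec W (.whileLt x y P) σ₁ t₂ σ₂) : Exec W (.whileLt x y P) σ₀ (t₁ + t₂ + 1) σ₂
  | while_false {x y : ℕ} {P : Program} {σ : Store}
      (h : ¬ σ.reg x < σ.reg y) : Exec W (.whileLt x y P) σ 1 σ

/-! ### Automata as inputs -/

open Classical in
/-- The description of an automaton with states `0, …, n-1` over the digits `0, …, b-1`: the number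
of states, the initial state, the transition table row by row, and for each state the flag
`1` (final) or `0` (not final). -/
noncomputable def encodeDFA {b n : ℕ} (A : DFA (Fin b) (Fin n)) : List ℕ :=
  [n, (A.start : ℕ)] ++
    (List.finRange n).flatMap (fun q => (List.finRange b).map fun a => (A.step q a : ℕ)) ++
    (List.finRange n).map (fun q => if q ∈ A.accept then 1 else 0)

/-- The initial store on input `A`: the description of `A` fills the memory from address `0` on, and
all the rest is `0`. -/
noncomputable def inputStore {b n : ℕ} (A : DFA (Fin b) (Fin n)) : Store where
  reg _ := 0
  mem i := (encodeDFA A).getD i 0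

/-!
A minimal automaton `A` is a quotient of a Pascal automaton exactly if there are permutations `g`
and `d` of its states, with `d` preserving acceptance, such that `A.step q a = d (g ^ a q)` and
`d * g ^ b = g * d`. Such permutations exist on every Pascal automaton, namely
`g (s, t) = (s + b ^ t, t)` and `d (s, t) = (s, t + 1)`, and they descend to its quotients.

Conversely, reading a word `w` sends the state `d ^ t * g ^ v` applied to the initial state to
`d ^ (t + |w|) * g ^ (v + b ^ t * val w)` applied to it, so its future language depends only on
`t`, `v` and the set `E` of all `k` for which `g ^ k` maps the initial state to a final one. As
`g ^ b` is conjugate to `g`, the order of `g`, which is a period of `E`, is coprime to `b`; so is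
the least period `p` of `E`. The future language of the state `(v, t)` of the Pascal automaton with
parameters `E` and `p` is the same, and a minimal automaton is a quotient of any automaton that
accepts its language and has no further future languages.

As `d` is the digit `0` and `d * g` the digit `1`, the existence of `g` and `d` comes down to
identities between compositions of the digits and the inverse of the digit `0`. Once the preimages
of each state under the digits `0` and `1` have been tabulated, they take boundedly many memory
accesses per state to check. No test that the digits are permutations is needed: if they are not,
some entry of the tables is wrong, and one of the identities fails.
-/

/-! ### Purely periodic sets of numbers -/

theorem mem_periodicSet_congr {R : Set ℕ} {p u v : ℕ} (huv : u ≡ v [MOD p]) :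
    u ∈ periodicSet R p ↔ v ∈ periodicSet R p :=
  exists_congr fun _ => and_congr_right fun _ => ⟨huv.symm.trans, huv.trans⟩

theorem periodicSet_residues {E : Set ℕ} {q : ℕ} (hq : 0 < q)
    (h : Function.Periodic (· ∈ E) q) : periodicSet {r | r ∈ E ∧ r < q} q = E := by
  ext v
  have mod_mem_iff : ∀ u, u % q ∈ E ↔ u ∈ E := fun u => (h.map_mod_nat u).to_iff
  constructor
  · rintro ⟨r, ⟨hr, -⟩, hv⟩
    rwa [← mod_mem_iff, hv, mod_mem_iff]
  · exact fun hv => ⟨v % q, ⟨(mod_mem_iff v).2 hv, Nat.mod_lt v hq⟩, (Nat.mod_modEq v q).symm⟩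

theorem isPeriodOf_iff_periodic {E : Set ℕ} {q : ℕ} :
    IsPeriodOf E q ↔ 0 < q ∧ Function.Periodic (· ∈ E) q := by
  constructor
  · rintro ⟨hq, S, -, rfl⟩
    exact ⟨hq, fun v => propext (mem_periodicSet_congr (by simp [Nat.ModEq]))⟩
  · rintro ⟨hq, h⟩
    exact ⟨hq, _, fun _ hr => hr.2, (periodicSet_residues hq h).symm⟩

theorem isPeriodicPt_preimage_succ_iff {E : Set ℕ} {q : ℕ} :
    Function.IsPeriodicPt (Set.preimage Nat.succ) q E ↔ Function.Periodic (· ∈ E) q := by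
  simp [Function.IsPeriodicPt, Function.IsFixedPt, ← Set.preimage_iterate_eq, Set.ext_iff,
    Function.Periodic, Nat.succ_iterate]

theorem exists_isCanonicalPair_of_periodic {E : Set ℕ} {N : ℕ} (hN : 0 < N)
    (h : Function.Periodic (· ∈ E) N) :
    ∃ p R, p ∣ N ∧ IsCanonicalPair R p ∧ periodicSet R p = E := by
  have hN' := isPeriodicPt_preimage_succ_iff.2 h
  set p := Function.minimalPeriod (Set.preimage Nat.succ) E
  have hp : 0 < p := hN'.minimalPeriod_pos hN
  have hpE : Function.Periodic (· ∈ E) p :=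
    isPeriodicPt_preimage_succ_iff.1 (Function.isPeriodicPt_minimalPeriod _ _)
  have hE := periodicSet_residues hp hpE
  refine ⟨p, _, hN'.minimalPeriod_dvd, ⟨fun _ hr => hr.2, ?_⟩, hE⟩
  rw [hE]
  refine ⟨isPeriodOf_iff_periodic.2 ⟨hp, hpE⟩, fun q hq => ?_⟩
  obtain ⟨hq, hqE⟩ := isPeriodOf_iff_periodic.1 hq
  exact (isPeriodicPt_preimage_succ_iff.2 hqE).minimalPeriod_le hq

/-! ### Quotients of automata -/

theorem IsMinimalDFA.isQuotientOf {α σ τ : Type*} {A : DFA α σ} {B : DFA α τ}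
    (hA : IsMinimalDFA A) (hlang : A.accepts = B.accepts)
    (hfuture : ∀ x, ∃ q, A.acceptsFrom q = B.acceptsFrom x) : IsQuotientOf A B := by
  choose φ hφ using hfuture
  have map_start : φ B.start = A.start := hA.reduced _ _ ((hφ _).trans hlang.symm)
  have map_step : ∀ x a, φ (B.step x a) = A.step (φ x) a := fun x a =>
    hA.reduced _ _ <| (hφ _).trans <| Set.ext fun w =>
      (Set.ext_iff.1 (hφ x) (a :: w)).symm
  have map_evalFrom : ∀ w x, φ (B.evalFrom x w) = A.evalFrom (φ x) w := by
    intro w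
    induction w with
    | nil => exact fun _ => rfl
    | cons a w ih => exact fun x => by rw [DFA.evalFrom_cons, ih, map_step, DFA.evalFrom_cons]
  refine ⟨φ, fun q => ?_, map_start, map_step, fun x => (Set.ext_iff.1 (hφ x) []).symm⟩
  obtain ⟨w, rfl⟩ := hA.accessible q
  exact ⟨B.eval w, by rw [DFA.eval, map_evalFrom, map_start, DFA.eval]⟩

/-! ### Pascal presentations -/

/-- The value of a base `b` numeral, least significant digit first. -/
def lsdValue {b : ℕ} (w : List (Fin b)) : ℕ := Nat.ofDigits b (w.map Fin.val)

/-- `g` and `d` present `A` as a Pascal automaton is presented by its permutations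
`g (s, t) = (s + b ^ t, t)` and `d (s, t) = (s, t + 1)`. -/
structure IsPascalPresentation {b : ℕ} {α : Type*} (A : DFA (Fin b) α) (g d : Equiv.Perm α) :
    Prop where
  step_eq : ∀ q a, A.step q a = d ((g ^ (a : ℕ)) q)
  semiconjBy : SemiconjBy d (g ^ b) g
  accept_iff : ∀ q, d q ∈ A.accept ↔ q ∈ A.accept

theorem semiconjBy_pow_left_pow_pow {M : Type*} [Monoid M] {d g : M} {b : ℕ}
    (h : SemiconjBy d (g ^ b) g) (t : ℕ) : SemiconjBy (d ^ t) (g ^ b ^ t) g := by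
  induction t with
  | zero => simp
  | succ t ih => simpa only [pow_succ, pow_succ' b, pow_mul] using ih.mul_left (h.pow_right (b ^ t))

theorem coprime_orderOf_of_semiconjBy_pow {G : Type*} [Group G] {d g : G} {b : ℕ}
    (hg : IsOfFinOrder g) (h : SemiconjBy d (g ^ b) g) : (orderOf g).Coprime b := by
  have hord := h.orderOf_eq d
  rw [hg.orderOf_pow, Nat.div_eq_self] at hord
  exact hord.resolve_left hg.orderOf_pos.ne'

namespace IsPascalPresentation

variable {b : ℕ} {α : Type*} {A : DFA (Fin b) α} {g d : Equiv.Perm α}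

theorem step_pow_mul_pow (h : IsPascalPresentation A g d) (t v : ℕ) (q : α) (a : Fin b) :
    A.step ((d ^ t * g ^ v) q) a = (d ^ (t + 1) * g ^ (v + b ^ t * a)) q := by
  have hcomm : g ^ (a : ℕ) * d ^ t = d ^ t * g ^ (b ^ t * a) := by
    rw [pow_mul]
    exact ((semiconjBy_pow_left_pow_pow h.semiconjBy t).pow_right a).symm
  calc A.step ((d ^ t * g ^ v) q) a
      = (d * (g ^ (a : ℕ) * d ^ t) * g ^ v) q := h.step_eq _ _
    _ = (d ^ (t + 1) * g ^ (v + b ^ t * a)) q := by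
      rw [hcomm, pow_succ', add_comm v, pow_add]
      simp only [mul_assoc]

theorem evalFrom_pow_mul_pow (h : IsPascalPresentation A g d) (q : α) (w : List (Fin b)) :
    ∀ t v, A.evalFrom ((d ^ t * g ^ v) q) w =
      (d ^ (t + w.length) * g ^ (v + b ^ t * lsdValue w)) q := by
  induction w with
  | nil => simp [lsdValue]
  | cons a w ih =>
    intro t v
    rw [DFA.evalFrom_cons, h.step_pow_mul_pow, ih, List.length_cons, add_right_comm, add_assoc t]
    simp only [lsdValue, List.map_cons, Nat.ofDigits_cons]
    ring_nf

theorem pow_apply_mem_accept_iff (h : IsPascalPresentation A g d) (t : ℕ) (q : α) :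
    (d ^ t) q ∈ A.accept ↔ q ∈ A.accept := by
  induction t with
  | zero => rfl
  | succ t ih => rw [pow_succ', Equiv.Perm.mul_apply, h.accept_iff, ih]

theorem mem_acceptsFrom_iff (h : IsPascalPresentation A g d) (t v : ℕ) (q : α)
    (w : List (Fin b)) :
    w ∈ A.acceptsFrom ((d ^ t * g ^ v) q) ↔ (g ^ (v + b ^ t * lsdValue w)) q ∈ A.accept := by
  rw [DFA.mem_acceptsFrom, h.evalFrom_pow_mul_pow, Equiv.Perm.mul_apply,
    h.pow_apply_mem_accept_iff]

theorem exists_of_isCovering {b : ℕ} {α β : Type*} [Finite β] {A : DFA (Fin (b + 2)) α}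
    {B : DFA (Fin (b + 2)) β} {φ : α → β} {g d : Equiv.Perm α} (h : IsPascalPresentation A g d)
    (hφ : IsCovering A B φ) : ∃ g' d', IsPascalPresentation B g' d' := by
  have step_bijective : ∀ a, Function.Bijective (B.step · a) := fun a =>
    (Finite.surjective_iff_bijective).1 fun y => by
      obtain ⟨x, rfl⟩ := hφ.surjective y
      refine ⟨φ ((g ^ (a : ℕ)).symm (d.symm x)), ?_⟩
      simp [← hφ.map_step, h.step_eq]
  let d' : Equiv.Perm β := .ofBijective _ (step_bijective 0)
  let e' : Equiv.Perm β := .ofBijective _ (step_bijective 1)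
  have map_d : ∀ x, d' (φ x) = φ (d x) := fun x => by
    simp [d', ← hφ.map_step, h.step_eq]
  have map_g : Function.Semiconj φ g ⇑(d'⁻¹ * e') := fun x => by
    rw [Equiv.Perm.mul_apply, Equiv.Perm.eq_inv_iff_eq, map_d]
    simp [e', ← hφ.map_step, h.step_eq]
  have map_pow : ∀ m x, ((d'⁻¹ * e') ^ m) (φ x) = φ ((g ^ m) x) := fun m x => by
    simpa only [Equiv.Perm.iterate_eq_pow] using (map_g.iterate_right m x).symm
  refine ⟨d'⁻¹ * e', d', fun y a => ?_, Equiv.ext fun y => ?_, fun y => ?_⟩ <;>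
    obtain ⟨x, rfl⟩ := hφ.surjective y
  · rw [← hφ.map_step, h.step_eq, map_pow, map_d]
  · simp only [Equiv.Perm.mul_apply (f := d'), map_pow, map_d]
    rw [Equiv.Perm.mul_apply (d'⁻¹ * e'), map_d, ← map_g.eq, ← Equiv.Perm.mul_apply,
      h.semiconjBy.eq, Equiv.Perm.mul_apply]
  · rw [map_d, ← hφ.mem_accept_iff, ← hφ.mem_accept_iff, h.accept_iff]

end IsPascalPresentation

/-! ### Quotients of Pascal automata -/

section PascalAutomaton

variable {b p : ℕ}

theorem orderOf_natCast_pos (hp : 0 < p) (h : p.Coprime b) : 0 < orderOf (b : ZMod p) := by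
  have : NeZero p := ⟨hp.ne'⟩
  rw [← ZMod.coe_unitOfCoprime b h.symm, orderOf_units]
  exact orderOf_pos _

theorem pow_val_add_one {M : Type*} [Monoid M] {x : M} [NeZero (orderOf x)]
    (t : ZMod (orderOf x)) : x ^ (t + 1).val = x ^ t.val * x := by
  obtain ⟨k, rfl⟩ := ZMod.natCast_zmod_surjective t
  rw [← Nat.cast_add_one]
  simp only [ZMod.val_natCast, pow_mod_orderOf, pow_succ]

/-- The permutation `(s, t) ↦ (s + b ^ t, t)` of the states of a Pascal automaton. -/
noncomputable def pascalTranslation (b p : ℕ) :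
    Equiv.Perm (ZMod p × ZMod (orderOf (b : ZMod p))) where
  toFun x := (x.1 + (b : ZMod p) ^ x.2.val, x.2)
  invFun x := (x.1 - (b : ZMod p) ^ x.2.val, x.2)
  left_inv x := by simp
  right_inv x := by simp

/-- The permutation `(s, t) ↦ (s, t + 1)` of the states of a Pascal automaton. -/
noncomputable def pascalShift (b p : ℕ) : Equiv.Perm (ZMod p × ZMod (orderOf (b : ZMod p))) :=
  (Equiv.refl _).prodCongr (Equiv.addRight 1)

theorem pascalTranslation_pow_apply (m : ℕ) (x : ZMod p × ZMod (orderOf (b : ZMod p))) :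
    (pascalTranslation b p ^ m) x = (x.1 + m * (b : ZMod p) ^ x.2.val, x.2) := by
  induction m with
  | zero => simp
  | succ m ih =>
    rw [pow_succ', Equiv.Perm.mul_apply, ih]
    simp only [pascalTranslation, Equiv.coe_fn_mk, Nat.cast_add, Nat.cast_one]
    ring_nf

theorem pascalShift_pow_apply (m : ℕ) (x : ZMod p × ZMod (orderOf (b : ZMod p))) :
    (pascalShift b p ^ m) x = (x.1, x.2 + m) := by
  induction m with
  | zero => simp
  | succ m ih =>
    rw [pow_succ', Equiv.Perm.mul_apply, ih]
    simp [pascalShift, add_assoc]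

theorem isPascalPresentation_pascalAutomaton [NeZero (orderOf (b : ZMod p))] (R : Set ℕ) :
    IsPascalPresentation (pascalAutomaton b p R) (pascalTranslation b p) (pascalShift b p) where
  step_eq x a := by
    simp [pascalTranslation_pow_apply, pascalShift, pascalAutomaton]
  semiconjBy := Equiv.ext fun x => by
    rw [Equiv.Perm.mul_apply, pascalTranslation_pow_apply]
    simp [pascalShift, pascalTranslation, pow_val_add_one, mul_comm]
  accept_iff _ := Iff.rfl

theorem pascalTranslation_pow_start_mem_accept_iff (R : Set ℕ) (v : ℕ) :
    (pascalTranslation b p ^ v) (pascalAutomaton b p R).start ∈ (pascalAutomaton b p R).accept ↔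
      v ∈ periodicSet R p := by
  rw [pascalTranslation_pow_apply]
  simp [pascalAutomaton, periodicSet, ← ZMod.natCast_eq_natCast_iff, eq_comm]

theorem exists_pow_mul_pow_start_eq [NeZero p] [NeZero (orderOf (b : ZMod p))] (R : Set ℕ)
    (x : ZMod p × ZMod (orderOf (b : ZMod p))) :
    ∃ t v, (pascalShift b p ^ t * pascalTranslation b p ^ v) (pascalAutomaton b p R).start = x :=
  ⟨x.2.val, x.1.val, by
    rw [Equiv.Perm.mul_apply, pascalTranslation_pow_apply, pascalShift_pow_apply]
    simp [pascalAutomaton]⟩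

end PascalAutomaton

theorem IsPascalQuotient.exists_isPascalPresentation {b : ℕ} {α : Type*}
    {A : DFA (Fin (b + 2)) α} (hA : IsPascalQuotient A) :
    ∃ g d, IsPascalPresentation A g d := by
  obtain ⟨p, R, hpb, ⟨-, hleast⟩, φ, hφ⟩ := hA
  have : NeZero p := ⟨hleast.1.1.ne'⟩
  have : NeZero (orderOf ((b + 2 : ℕ) : ZMod p)) := ⟨(orderOf_natCast_pos hleast.1.1 hpb).ne'⟩
  have : Finite α := .of_surjective φ hφ.surjective
  exact (isPascalPresentation_pascalAutomaton R).exists_of_isCovering hφ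

theorem IsPascalPresentation.isPascalQuotient {b : ℕ} {α : Type*} [Finite α]
    {A : DFA (Fin b) α} {g d : Equiv.Perm α} (h : IsPascalPresentation A g d)
    (hA : IsMinimalDFA A) : IsPascalQuotient A := by
  have hg : IsOfFinOrder g := isOfFinOrder_of_finite g
  have hper : Function.Periodic (· ∈ {v | (g ^ v) A.start ∈ A.accept}) (orderOf g) := fun v => by
    simp [pow_add, pow_orderOf_eq_one]
  obtain ⟨p, R, hpg, hcan, hE⟩ := exists_isCanonicalPair_of_periodic hg.orderOf_pos hper
  have hpb : p.Coprime b :=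
    (coprime_orderOf_of_semiconjBy_pow hg h.semiconjBy).coprime_dvd_left hpg
  have hp : 0 < p := hcan.2.1.1
  have : NeZero p := ⟨hp.ne'⟩
  have : NeZero (orderOf (b : ZMod p)) := ⟨(orderOf_natCast_pos hp hpb).ne'⟩
  have same_future : ∀ t v, A.acceptsFrom ((d ^ t * g ^ v) A.start) =
      (pascalAutomaton b p R).acceptsFrom
        ((pascalShift b p ^ t * pascalTranslation b p ^ v) (pascalAutomaton b p R).start) := by
    intro t v
    ext w
    rw [h.mem_acceptsFrom_iff, (isPascalPresentation_pascalAutomaton R).mem_acceptsFrom_iff,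
      pascalTranslation_pow_start_mem_accept_iff, hE]
    rfl
  refine ⟨p, R, hpb, hcan, hA.isQuotientOf (same_future 0 0) fun x => ?_⟩
  obtain ⟨t, v, rfl⟩ := exists_pow_mul_pow_start_eq R x
  exact ⟨_, same_future t v⟩

/-! ### Pointwise relations -/

/-- The relations at the state `q` that an automaton has to satisfy in order to have a Pascal
presentation, for candidates `pre₀` and `pre₁` for the inverses of the digits `0` and `1`. The
permutation `g` of the presentation is `fun q => pre₀ (A.step q 1)`. -/
structure PascalRelationsAt {b : ℕ} {α : Type*} (A : DFA (Fin (b + 2)) α) (pre₀ pre₁ : α → α)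
    (q : α) : Prop where
  pre_step_zero : pre₀ (A.step q 0) = q
  pre_step_one : pre₁ (A.step q 1) = q
  step_succ : ∀ a : Fin (b + 1), A.step q a.succ = A.step (pre₀ (A.step q 1)) a.castSucc
  carry : pre₀ (A.step (A.step q 0) 1) = A.step (pre₀ (A.step q 1)) (Fin.last (b + 1))
  accept_iff : A.step q 0 ∈ A.accept ↔ q ∈ A.accept

section PascalRelations

variable {b : ℕ} {α : Type*} {A : DFA (Fin (b + 2)) α} {pre₀ pre₁ : α → α}

theorem IsPascalPresentation.pascalRelationsAt {g d : Equiv.Perm α}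
    (h : IsPascalPresentation A g d)
    (hpre₀ : Function.Injective (A.step · 0) → Function.LeftInverse pre₀ (A.step · 0))
    (hpre₁ : Function.Injective (A.step · 1) → Function.LeftInverse pre₁ (A.step · 1)) (q : α) :
    PascalRelationsAt A pre₀ pre₁ q := by
  have step_zero : ∀ x, A.step x 0 = d x := fun x => by simp [h.step_eq]
  have step_one : ∀ x, A.step x 1 = d (g x) := fun x => by simp [h.step_eq]
  have pre₀_d : ∀ x, pre₀ (d x) = x := by
    simpa [Function.LeftInverse, step_zero, d.injective] using hpre₀
  have pre₁_d_g : ∀ x, pre₁ (d (g x)) = x := by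
    simpa only [Function.LeftInverse, step_one] using
      hpre₁ (by simp only [step_one]; exact d.injective.comp g.injective)
  constructor
  · rw [step_zero, pre₀_d]
  · rw [step_one, pre₁_d_g]
  · intro a
    simp [h.step_eq _ a.succ, h.step_eq _ a.castSucc, step_one, pre₀_d, pow_succ]
  · rw [step_one, pre₀_d, step_zero, step_one, pre₀_d, h.step_eq, Fin.val_last,
      ← Equiv.Perm.mul_apply, ← h.semiconjBy.eq, Equiv.Perm.mul_apply, pow_succ,
      Equiv.Perm.mul_apply]
  · rw [step_zero, h.accept_iff]

theorem exists_isPascalPresentation_of_pascalRelationsAt [Finite α]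
    (h : ∀ q, PascalRelationsAt A pre₀ pre₁ q) : ∃ g d, IsPascalPresentation A g d := by
  have step_bijective {pre : α → α} {a : Fin (b + 2)} (hpre : ∀ q, pre (A.step q a) = q) :
      Function.Bijective (A.step · a) :=
    Finite.injective_iff_bijective.1 (Function.LeftInverse.injective hpre)
  let d : Equiv.Perm α := .ofBijective _ (step_bijective fun q => (h q).pre_step_zero)
  let e : Equiv.Perm α := .ofBijective _ (step_bijective fun q => (h q).pre_step_one)
  have g_apply : ∀ q, pre₀ (A.step q 1) = (d⁻¹ * e) q := fun q => by
    obtain ⟨x, hx⟩ := d.surjective (e q)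
    rw [Equiv.Perm.mul_apply, ← Equiv.Perm.eq_inv_iff_eq.2 hx]
    exact (congrArg pre₀ hx.symm).trans (h x).pre_step_zero
  have step_eq : ∀ (a : Fin (b + 2)) q, A.step q a = d (((d⁻¹ * e) ^ (a : ℕ)) q) := by
    intro a
    induction a using Fin.induction with
    | zero => exact fun _ => rfl
    | succ a ih =>
      intro q
      rw [(h q).step_succ, g_apply, ih, Fin.val_succ, pow_succ, Equiv.Perm.mul_apply _ (d⁻¹ * e),
        Fin.val_castSucc]
  refine ⟨d⁻¹ * e, d, fun q a => step_eq a q, Equiv.ext fun q => ?_, fun q => (h q).accept_iff⟩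
  have hcarry := (h q).carry
  rw [g_apply, g_apply, step_eq (Fin.last _), Fin.val_last, ← Equiv.Perm.mul_apply (_ ^ _),
    ← pow_succ] at hcarry
  exact hcarry.symm

end PascalRelations

/-! ### Running programs -/

/-- From the store `σ` the program `P` reaches a store with the property `Post` in at most `T`
steps, on a machine with words `0, …, W`. -/
def RunsTo (W : ℕ) (P : Program) (T : ℕ) (σ : Store) (Post : Store → Prop) : Prop :=
  ∃ t ≤ T, ∃ σ', Exec W P σ t σ' ∧ Post σ'

namespace RunsTo

variable {W T T₁ T₂ : ℕ} {P Q : Program} {σ : Store} {Mid Post Post' : Store → Prop}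

theorem of_exec {t : ℕ} {σ' : Store} (h : Exec W P σ t σ') (hT : t ≤ T) (hσ' : Post σ') :
    RunsTo W P T σ Post :=
  ⟨t, hT, σ', h, hσ'⟩

theorem mono (h : RunsTo W P T₁ σ Post) (hT : T₁ ≤ T₂) (hPost : ∀ σ', Post σ' → Post' σ') :
    RunsTo W P T₂ σ Post' :=
  let ⟨t, ht, σ', h, hσ'⟩ := h
  ⟨t, ht.trans hT, σ', h, hPost σ' hσ'⟩

theorem seq (h₁ : RunsTo W P T₁ σ Mid) (h₂ : ∀ σ', Mid σ' → RunsTo W Q T₂ σ' Post) :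
    RunsTo W (.seq P Q) (T₁ + T₂) σ Post :=
  let ⟨t₁, ht₁, σ₁, h₁, hσ₁⟩ := h₁
  let ⟨t₂, ht₂, σ₂, h₂, hσ₂⟩ := h₂ σ₁ hσ₁
  ⟨t₁ + t₂, Nat.add_le_add ht₁ ht₂, σ₂, .seq h₁ h₂, hσ₂⟩

theorem whileLt {x y n : ℕ} (Inv : ℕ → Store → Prop)
    (hreg : ∀ k σ, Inv k σ → σ.reg x = k ∧ σ.reg y = n)
    (hbody : ∀ k < n, ∀ σ, Inv k σ → RunsTo W P T σ (Inv (k + 1))) (hσ : Inv 0 σ) :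
    RunsTo W (.whileLt x y P) (n * (T + 1) + 1) σ (Inv n) := by
  suffices h : ∀ d k, k + d = n → ∀ σ, Inv k σ →
      RunsTo W (.whileLt x y P) (d * (T + 1) + 1) σ (Inv n) from h n 0 n.zero_add σ hσ
  intro d
  induction d with
  | zero =>
    rintro k rfl σ hk
    obtain ⟨hx, hy⟩ := hreg k σ hk
    exact of_exec (.while_false (by omega)) (by omega) hk
  | succ d ih =>
    intro k hkd σ hk
    obtain ⟨hx, hy⟩ := hreg k σ hk
    obtain ⟨t₁, ht₁, σ₁, he₁, hk₁⟩ := hbody k (by omega) σ hk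
    obtain ⟨t₂, ht₂, σ₂, he₂, hn⟩ := ih (k + 1) (by omega) σ₁ hk₁
    exact of_exec (.while_true (by omega) he₁ he₂) (by rw [add_mul]; omega) hn

end RunsTo

@[simp] theorem Store.setReg_reg (σ : Store) (x v y : ℕ) :
    (σ.setReg x v).reg y = if y = x then v else σ.reg y := by
  simp [setReg, Function.update_apply]

/-- The register allocation of all programs below: register `0` holds the answer `r`, register `1`
the number `n` of states, register `2` the loop counter `q`. Register `3` is used for addresses, and
further registers for intermediate values. -/
structure HasContents (n q r : ℕ) (m : ℕ → ℕ) (σ : Store) : Prop where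
  answer : σ.reg 0 = r
  size : σ.reg 1 = n
  counter : σ.reg 2 = q
  memory : σ.mem = m

namespace HasContents

variable {n q r : ℕ} {m : ℕ → ℕ} {σ : Store}

theorem setReg (h : HasContents n q r m σ) {x : ℕ} (hx : 2 < x) (v : ℕ) :
    HasContents n q r m (σ.setReg x v) := by
  constructor <;> simp [Store.setReg, Function.update_of_ne, hx.ne, show 0 ≠ x by omega,
    show 1 ≠ x by omega, h.answer, h.size, h.counter, h.memory]

theorem setAnswer (h : HasContents n q r m σ) (v : ℕ) :
    HasContents n q v m (σ.setReg 0 v) :=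
  ⟨by simp, by simp [h.size], by simp [h.counter], h.memory⟩

theorem setCounter (h : HasContents n q r m σ) (v : ℕ) :
    HasContents n v r m (σ.setReg 2 v) :=
  ⟨by simp [h.answer], by simp [h.size], by simp, h.memory⟩

theorem setMem (h : HasContents n q r m σ) (i v : ℕ) :
    HasContents n q r (Function.update m i v) (σ.setMem i v) :=
  ⟨h.answer, h.size, h.counter, by simp [Store.setMem, h.memory]⟩

end HasContents

/-- The program that runs `P` for the values `0, …, n - 1` of the loop counter. -/
def forLoop (P : Program) : Program :=
  .seq (.const 2 0) (.whileLt 2 1 (.seq P (.seq (.const 3 1) (.add 2 2 3))))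

theorem runsTo_increment {W n q r : ℕ} {m : ℕ → ℕ} (hqW : q + 1 ≤ W) {σ : Store}
    (hσ : HasContents n q r m σ) :
    RunsTo W (.seq (.const 3 1) (.add 2 2 3)) 2 σ (HasContents n (q + 1) r m) :=
  .of_exec (.seq (.const σ 3 1 (by omega)) (.add _ 2 2 3 (by simpa [hσ.counter]))) le_rfl <| by
    simpa [hσ.counter] using (hσ.setReg (x := 3) (by omega) 1).setCounter (q + 1)

theorem runsTo_forLoop {W T n q : ℕ} {P : Program} {r : ℕ → ℕ} {m : ℕ → ℕ → ℕ} (hnW : n ≤ W)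
    (hbody : ∀ k < n, ∀ σ, HasContents n k (r k) (m k) σ →
      RunsTo W P T σ (HasContents n k (r (k + 1)) (m (k + 1))))
    {σ : Store} (hσ : HasContents n q (r 0) (m 0) σ) :
    RunsTo W (forLoop P) (n * (T + 3) + 2) σ (HasContents n n (r n) (m n)) := by
  have hreset : RunsTo W (.const 2 0) 1 σ (HasContents n 0 (r 0) (m 0)) :=
    .of_exec (.const σ 2 0 W.zero_le) le_rfl (hσ.setCounter 0)
  refine (hreset.seq fun σ₀ hσ₀ => RunsTo.whileLt (fun k => HasContents n k (r k) (m k))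
    (fun k σ h => ⟨h.counter, h.size⟩) (fun k hk σ h => ?_) hσ₀).mono
    (T₁ := 1 + (n * (T + 3) + 1)) (by omega) fun _ => id
  exact (hbody k hk σ h).seq fun σ' h' => runsTo_increment (by omega) h'

/-! ### Memory terms -/

/-- `x := x + k * y` -/
def addMul (x y : ℕ) : ℕ → Program
  | 0 => .skip
  | k + 1 => .seq (.add x x y) (addMul x y k)

theorem runsTo_addMul {W x y : ℕ} (hxy : y ≠ x) (k : ℕ) {σ : Store}
    (h : σ.reg x + k * σ.reg y ≤ W) :
    RunsTo W (addMul x y k) (k + 1) σ (· = σ.setReg x (σ.reg x + k * σ.reg y)) := by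
  induction k generalizing σ with
  | zero => exact .of_exec (.skip σ) le_rfl (by simp [Store.setReg])
  | succ k ih =>
    rw [add_mul, one_mul] at h
    have hadd := Exec.add σ x x y (W := W) (by omega)
    refine (RunsTo.of_exec (Post := (· = _)) hadd le_rfl rfl).seq ?_ |>.mono (T₁ := 1 + (k + 1))
      (by omega) fun _ => id
    rintro _ rfl
    have hle : (σ.setReg x (σ.reg x + σ.reg y)).reg x +
        k * (σ.setReg x (σ.reg x + σ.reg y)).reg y ≤ W := by
      simp only [Store.setReg_reg, if_pos, if_neg hxy]
      omega
    refine (ih hle).mono le_rfl ?_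
    rintro _ rfl
    simp [Store.setReg, Function.update_of_ne hxy, add_mul, add_assoc, add_comm (σ.reg y)]

/-- The program that puts the address `c + j * n + k * x` into register `3`. -/
def address (c j k x : ℕ) : Program :=
  .seq (.const 3 c) (.seq (addMul 3 1 j) (addMul 3 x k))

theorem runsTo_address {W n q r c j k x : ℕ} {m : ℕ → ℕ} (hx : x ≠ 3) {σ : Store}
    (hσ : HasContents n q r m σ) (h : c + j * n + k * σ.reg x ≤ W) :
    RunsTo W (address c j k x) (j + k + 3) σ (· = σ.setReg 3 (c + j * n + k * σ.reg x)) := by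
  have hconst := Exec.const σ 3 c (W := W) (by omega)
  refine (RunsTo.of_exec (Post := (· = _)) hconst le_rfl rfl).seq (T₂ := j + 1 + (k + 1)) ?_
    |>.mono (by omega) fun _ => id
  rintro _ rfl
  refine (runsTo_addMul (by omega) j (by simpa [hσ.size] using le_of_add_le_left h)).seq ?_
  rintro _ rfl
  refine (runsTo_addMul hx k (by simp [hσ.size, hx, h])).mono le_rfl ?_
  rintro _ rfl
  simp [Store.setReg, hx, hσ.size]

theorem address_le {n c j k v : ℕ} (hn : 0 < n) (hv : v ≤ n) :
    c + j * n + k * v ≤ (c + j + k) * n := by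
  calc c + j * n + k * v ≤ c * n + j * n + k * n := by
        gcongr
        exact Nat.le_mul_of_pos_right c hn
    _ = (c + j + k) * n := by ring

/-- Terms for the values that can be looked up in the memory from the loop counter. -/
inductive MemTerm where
  /-- the loop counter -/
  | counter : MemTerm
  /-- the content of the cell with address `c + j * n + k * e` -/
  | cell (c j k : ℕ) (e : MemTerm) : MemTerm

namespace MemTerm

/-- The value of a term, for the memory `m`, the number `n` of states and the loop counter `q`. -/
def eval (m : ℕ → ℕ) (n q : ℕ) : MemTerm → ℕ
  | counter => q
  | cell c j k e => m (c + j * n + k * e.eval m n q)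

/-- The program that puts the value of a term into register `y`. -/
def program (y : ℕ) : MemTerm → Program
  | counter => .copy y 2
  | cell c j k e => .seq (e.program y) (.seq (address c j k y) (.load y 3))

/-- A bound for the time, and for the addresses as multiples of `n`. -/
def cost : MemTerm → ℕ
  | counter => 1
  | cell c j k e => e.cost + (c + j + k + 4)

theorem eval_le {m : ℕ → ℕ} {n q : ℕ} (hm : ∀ i, m i ≤ n) (hq : q ≤ n) (e : MemTerm) :
    e.eval m n q ≤ n := by
  cases e with
  | counter => exact hq
  | cell => exact hm _

theorem runsTo_program {W n q r y : ℕ} {m : ℕ → ℕ} (hm : ∀ i, m i ≤ n) (hq : q < n) (hy : 3 < y)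
    (e : MemTerm) (hW : e.cost * n ≤ W) {σ : Store} (hσ : HasContents n q r m σ) :
    RunsTo W (e.program y) e.cost σ fun σ' =>
      HasContents n q r m σ' ∧ σ'.reg y = e.eval m n q ∧
        ∀ x, x ≠ 3 → x ≠ y → σ'.reg x = σ.reg x := by
  induction e with
  | counter =>
    exact .of_exec (.copy σ y 2) le_rfl
      ⟨hσ.setReg (by omega) _, by simp [hσ.counter, eval], fun x _ hx => by simp [hx]⟩
  | cell c j k e ih =>
    rw [cost, add_mul, add_mul _ 4] at hW
    refine ((ih (by omega)).seq (T₂ := j + k + 3 + 1) ?_).mono (by rw [cost]; omega) fun _ => id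
    rintro σ₁ ⟨hσ₁, hy₁, hframe⟩
    have haddr := address_le (c := c) (j := j) (k := k) (by omega) (eval_le hm hq.le e)
    refine (runsTo_address (by omega) hσ₁ (by rw [hy₁]; omega)).seq ?_
    rintro _ rfl
    refine .of_exec (.load _ y 3) le_rfl
      ⟨(hσ₁.setReg (by omega) _).setReg (by omega) _, ?_, fun x hx₃ hxy => ?_⟩
    · simp [Store.setReg, hσ₁.memory, hy₁, eval]
    · simp [hx₃, hxy, hframe x hx₃ hxy]

end MemTerm

/-! ### Checking equations between memory terms -/

/-- The program that clears register `0` unless the registers `x` and `y` are equal. -/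
def checkEq (x y : ℕ) : Program :=
  .ifLt x y (.const 0 0) (.ifLt y x (.const 0 0) .skip)

theorem runsTo_checkEq {W x y : ℕ} {σ : Store} :
    RunsTo W (checkEq x y) 3 σ
      (· = σ.setReg 0 (if σ.reg x = σ.reg y then σ.reg 0 else 0)) := by
  have hclear := Exec.const σ 0 0 W.zero_le
  rcases lt_trichotomy (σ.reg x) (σ.reg y) with h | h | h
  · exact .of_exec (.ifLt_true h hclear) (by omega) (by rw [if_neg h.ne])
  · exact .of_exec (.ifLt_false h.not_lt (.ifLt_false h.not_gt (.skip σ))) (by omega)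
      (by simp [h, Store.setReg])
  · exact .of_exec (.ifLt_false h.not_gt (.ifLt_true h hclear)) (by omega) (by rw [if_neg h.ne'])

/-- The program that clears register `0` unless all the equations hold. -/
def checkAll : List (MemTerm × MemTerm) → Program
  | [] => .skip
  | e :: l => .seq (e.1.program 4) (.seq (e.2.program 5) (.seq (checkEq 4 5) (checkAll l)))

/-- A bound for the time, and for the addresses as multiples of `n`. -/
def checkCost : List (MemTerm × MemTerm) → ℕ
  | [] => 1
  | e :: l => e.1.cost + (e.2.cost + (3 + checkCost l))

open Classical in
theorem runsTo_checkAll {W n q r : ℕ} {m : ℕ → ℕ} (hm : ∀ i, m i ≤ n) (hq : q < n)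
    (l : List (MemTerm × MemTerm)) (hW : checkCost l * n ≤ W) {σ : Store}
    (hσ : HasContents n q r m σ) :
    RunsTo W (checkAll l) (checkCost l) σ
      (HasContents n q (if ∀ e ∈ l, e.1.eval m n q = e.2.eval m n q then r else 0) m) := by
  induction l generalizing r σ with
  | nil => exact .of_exec (.skip σ) le_rfl (by simpa)
  | cons e l ih =>
    simp only [checkCost, add_mul] at hW
    refine (e.1.runsTo_program hm hq (by omega) (by omega) hσ).seq ?_
    rintro σ₁ ⟨hσ₁, h₄, -⟩
    refine (e.2.runsTo_program hm hq (by omega) (by omega) hσ₁).seq ?_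
    rintro σ₂ ⟨hσ₂, h₅, hframe⟩
    refine runsTo_checkEq.seq ?_
    rintro _ rfl
    rw [hframe 4 (by omega) (by omega), h₄, h₅, hσ₂.answer]
    refine (ih (by omega) (hσ₂.setAnswer _)).mono le_rfl fun _ => ?_
    simp only [List.forall_mem_cons, ← ite_and, and_comm, imp_self]

open Classical in
theorem runsTo_forLoop_checkAll {W n q r : ℕ} {m : ℕ → ℕ} (hm : ∀ i, m i ≤ n) (hnW : n ≤ W)
    (l : List (MemTerm × MemTerm)) (hW : checkCost l * n ≤ W) {σ : Store}
    (hσ : HasContents n q r m σ) :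
    RunsTo W (forLoop (checkAll l)) (n * (checkCost l + 3) + 2) σ
      (HasContents n n
        (if ∀ q < n, ∀ e ∈ l, e.1.eval m n q = e.2.eval m n q then r else 0) m) := by
  refine runsTo_forLoop (m := fun _ => m)
    (r := fun k => if ∀ q < k, ∀ e ∈ l, e.1.eval m n q = e.2.eval m n q then r else 0)
    hnW (fun k hk σ h => ?_) (by simpa using hσ)
  simpa only [← ite_and, Nat.forall_lt_succ_right, and_comm] using runsTo_checkAll hm hk l hW h

/-! ### Tabulating preimages -/

/-- The memory `m` after `q` has been written to the address `s + f q`, for `q = 0, …, k - 1` in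
turn: if `f` is injective, this is a table of preimages under `f`, starting at the address `s`. -/
def preimageTable (m : ℕ → ℕ) (s : ℕ) (f : ℕ → ℕ) : ℕ → ℕ → ℕ
  | 0 => m
  | k + 1 => Function.update (preimageTable m s f k) (s + f k) k

section PreimageTable

variable {m f : ℕ → ℕ} {s i : ℕ}

theorem preimageTable_of_lt (hi : i < s) (k : ℕ) : preimageTable m s f k i = m i := by
  induction k with
  | zero => rfl
  | succ k ih => rw [preimageTable, Function.update_of_ne (by omega), ih]

theorem preimageTable_eq_or_lt (i k : ℕ) :
    preimageTable m s f k i = m i ∨ preimageTable m s f k i < k := by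
  induction k with
  | zero => exact .inl rfl
  | succ k ih =>
    rw [preimageTable, Function.update_apply]
    split_ifs <;> omega

theorem preimageTable_apply {k q : ℕ} (hf : Set.InjOn f (Set.Iio k)) (hq : q < k) :
    preimageTable m s f k (s + f q) = q := by
  induction k with
  | zero => omega
  | succ k ih =>
    rcases Nat.lt_succ_iff_lt_or_eq.1 hq with hqk | rfl
    · have hne : f q ≠ f k := fun h => hqk.ne (hf hq k.lt_succ_self h)
      rw [preimageTable, Function.update_of_ne (by omega),
        ih (hf.mono (Set.Iio_subset_Iio k.le_succ)) hqk]
    · exact Function.update_self ..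

end PreimageTable

/-- The program that writes the loop counter into the cell with address `2 + j * n + e`. -/
def tabulate (j : ℕ) (e : MemTerm) : Program :=
  .seq (e.program 4) (.seq (address 2 j 1 4) (.store 3 2))

/-- A bound for the time, and for the addresses as multiples of `n`. -/
def tabulateCost (j : ℕ) (e : MemTerm) : ℕ := e.cost + (j + 5)

theorem runsTo_tabulate {W n q r j : ℕ} {m : ℕ → ℕ} (hm : ∀ i, m i ≤ n) (hq : q < n) (e : MemTerm)
    (hW : tabulateCost j e * n ≤ W) {σ : Store} (hσ : HasContents n q r m σ) :
    RunsTo W (tabulate j e) (tabulateCost j e) σ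
      (HasContents n q r (Function.update m (2 + j * n + e.eval m n q) q)) := by
  rw [tabulateCost, add_mul] at hW
  refine (e.runsTo_program hm hq (by omega) (by omega) hσ).seq (T₂ := j + 1 + 3 + 1) ?_
  rintro σ₁ ⟨hσ₁, h₄, -⟩
  have haddr := address_le (c := 2) (j := j) (k := 1) (by omega) (e.eval_le hm hq.le)
  have hle : (2 + j + 1) * n ≤ (j + 5) * n := Nat.mul_le_mul_right n (by omega)
  refine (runsTo_address (by omega) hσ₁ (by rw [h₄]; omega)).seq ?_
  rintro _ rfl
  refine .of_exec (.store _ 3 2) le_rfl ?_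
  simpa [h₄, hσ₁.counter] using
    (hσ₁.setReg (x := 3) (by omega) (2 + j * n + e.eval m n q)).setMem (2 + j * n + e.eval m n q) q

/-! ### Automata in the memory -/

open Classical in
/-- The memory `m` holds the automaton `A` in the layout of `encodeDFA`, and behind it only numbers
of states. -/
structure StoresDFA {b n : ℕ} (A : DFA (Fin b) (Fin n)) (m : ℕ → ℕ) : Prop where
  le : ∀ i, m i ≤ n
  lt : ∀ i, 2 + (b + 1) * n ≤ i → m i < n
  step : ∀ (q : Fin n) (a : Fin b), m (2 + a + b * q) = A.step q a
  accept : ∀ q : Fin n, m (2 + b * n + q) = if q ∈ A.accept then 1 else 0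

section Input

theorem add_mul_lt_mul_of_lt {a b q n : ℕ} (ha : a < b) (hq : q < n) : a + b * q < b * n := by
  calc a + b * q < b * (q + 1) := by rw [mul_add_one]; omega
    _ ≤ b * n := Nat.mul_le_mul_left b hq

theorem getD_flatMap_of_length_eq {β γ : Type*} {b : ℕ} {g : β → List γ}
    (hg : ∀ x, (g x).length = b) {l : List β} {k a : ℕ} (ha : a < b) (hk : k < l.length) (z : γ) :
    (l.flatMap g).getD (a + b * k) z = (g l[k]).getD a z := by
  induction l generalizing k with
  | nil => exact absurd hk k.not_lt_zero
  | cons x l ih =>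
    rw [List.flatMap_cons]
    cases k with
    | zero => rw [List.getD_append _ _ _ _ (by simpa [hg])]; rfl
    | succ k =>
      rw [List.getD_append_right _ _ _ _ (by rw [hg, mul_add]; omega), hg, mul_add_one,
        ← Nat.add_assoc, Nat.add_sub_cancel, ih (Nat.lt_of_succ_lt_succ hk),
        List.getElem_cons_succ]

variable {b n : ℕ} (A : DFA (Fin b) (Fin n))

theorem length_append_flatMap_step :
    ([n, (A.start : ℕ)] ++ (List.finRange n).flatMap fun q =>
      (List.finRange b).map fun a => (A.step q a : ℕ)).length = 2 + b * n :=
  List.length_append.trans (congrArg (2 + ·) (by simp [mul_comm n]))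

theorem length_encodeDFA : (encodeDFA A).length = 2 + (b + 1) * n := by
  rw [encodeDFA, List.length_append, length_append_flatMap_step, List.length_map,
    List.length_finRange, add_one_mul, add_assoc]

theorem le_of_mem_encodeDFA {x : ℕ} (hx : x ∈ encodeDFA A) : x ≤ n := by
  have hn : 0 < n := A.start.pos
  simp only [encodeDFA, List.mem_append, List.mem_cons, List.mem_flatMap, List.mem_map,
    List.not_mem_nil, or_false] at hx
  rcases hx with ((rfl | rfl) | ⟨q, -, a, -, rfl⟩) | ⟨q, -, rfl⟩
  · rfl
  · exact Fin.is_le'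
  · exact Fin.is_le'
  · split_ifs <;> omega

theorem inputStore_mem_zero : (inputStore A).mem 0 = n := by
  simp [inputStore, encodeDFA]

theorem storesDFA_inputStore : StoresDFA A (inputStore A).mem where
  le i := by
    rcases lt_or_ge i (encodeDFA A).length with hi | hi
    · exact (List.getD_eq_getElem _ _ hi).trans_le (le_of_mem_encodeDFA A (List.getElem_mem hi))
    · exact (List.getD_eq_default _ _ hi).trans_le n.zero_le
  lt i hi :=
    (List.getD_eq_default _ _ (by rwa [length_encodeDFA])).trans_lt A.start.pos
  step q a := by
    have hlt := add_mul_lt_mul_of_lt a.2 q.2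
    change (encodeDFA A).getD _ 0 = _
    rw [encodeDFA, List.getD_append _ _ _ _ (by rw [length_append_flatMap_step]; omega), add_assoc,
      List.getD_append_right _ _ _ _ (Nat.le_add_right 2 _),
      show 2 + (a + b * q) - [n, (A.start : ℕ)].length = a + b * q from Nat.add_sub_cancel_left ..,
      getD_flatMap_of_length_eq (by simp) a.2 (by simp)]
    simp
  accept q := by
    change (encodeDFA A).getD _ 0 = _
    rw [encodeDFA, List.getD_append_right _ _ _ _ (by rw [length_append_flatMap_step]; omega),
      length_append_flatMap_step, Nat.add_sub_cancel_left, List.getD_eq_getElem _ _ (by simp),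
      List.getElem_map, List.getElem_finRange]
    rfl

end Input

/-- The memory `m` extended by a table of preimages under the digit `a`, for automata over
`b` digits with `n` states. The tables for the digits `0, 1, …` follow the automaton one after the
other. -/
def withPreimages (b n a : ℕ) (m : ℕ → ℕ) : ℕ → ℕ :=
  preimageTable m (2 + (b + 1 + a) * n) (fun q => m (2 + a + b * q)) n

theorem encodeDFA_end_le_table_start (b n a : ℕ) : 2 + (b + 1) * n ≤ 2 + (b + 1 + a) * n :=
  Nat.add_le_add_left (Nat.mul_le_mul_right n (Nat.le_add_right _ a)) 2

namespace StoresDFA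

variable {b n : ℕ} {A : DFA (Fin b) (Fin n)} {m m' : ℕ → ℕ}

theorem storesDFA_preimageTable (h : StoresDFA A m) {s : ℕ} (hs : 2 + (b + 1) * n ≤ s)
    (f : ℕ → ℕ) {k : ℕ} (hk : k ≤ n) : StoresDFA A (preimageTable m s f k) where
  le i := by
    have := h.le i
    have := preimageTable_eq_or_lt (m := m) (f := f) (s := s) i k
    omega
  lt i hi := by
    have := h.lt i hi
    have := preimageTable_eq_or_lt (m := m) (f := f) (s := s) i k
    omega
  step q a := by
    have := add_mul_lt_mul_of_lt a.2 q.2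
    rw [add_one_mul] at hs
    rw [preimageTable_of_lt (by omega), h.step]
  accept q := by
    rw [add_one_mul] at hs
    rw [preimageTable_of_lt (by omega), h.accept]

theorem storesDFA_withPreimages (h : StoresDFA A m) (a : ℕ) : StoresDFA A (withPreimages b n a m) :=
  h.storesDFA_preimageTable (encodeDFA_end_le_table_start b n a) _ le_rfl

/-- The table for the digit `a`, as a map on states. -/
def table (h : StoresDFA A m) (a : Fin b) (y : Fin n) : Fin n :=
  ⟨m (2 + (b + 1 + a) * n + y),
    h.lt _ (Nat.le_add_right_of_le (encodeDFA_end_le_table_start b n a))⟩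

theorem leftInverse_table (h : StoresDFA A m) (h' : StoresDFA A m') {a : Fin b}
    (hm' : ∀ i < 2 + (b + 1 + (a + 1)) * n, m' i = withPreimages b n a m i)
    (ha : Function.Injective (A.step · a)) : Function.LeftInverse (h'.table a) (A.step · a) := by
  intro q
  have hinj : Set.InjOn (fun q => m (2 + a + b * q)) (Set.Iio n) := by
    intro x hx y hy hxy
    simp only [h.step ⟨x, hx⟩ a, h.step ⟨y, hy⟩ a] at hxy
    exact congrArg Fin.val (ha (Fin.ext hxy))
  ext
  have hlt : 2 + (b + 1 + a) * n + (A.step q a : ℕ) < 2 + (b + 1 + (a + 1)) * n := by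
    have := (A.step q a).2
    rw [← add_assoc _ _ 1, add_one_mul _ n]
    omega
  refine (hm' _ hlt).trans ?_
  rw [withPreimages, ← h.step]
  exact preimageTable_apply hinj q.2

end StoresDFA

/-! ### The decision procedure -/

namespace MemTerm

/-- The successor of the state `e` by the digit `a`. -/
def digit {b : ℕ} (a : Fin b) (e : MemTerm) : MemTerm := cell (2 + a) 0 b e

/-- The flag that tells whether the state `e` is final. -/
def flag (b : ℕ) (e : MemTerm) : MemTerm := cell 2 b 1 e

/-- The entry for the state `e` in the table of preimages under the digit `a`. -/
def preimage {b : ℕ} (a : Fin b) (e : MemTerm) : MemTerm := cell 2 (b + 1 + a) 1 e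

section Eval

variable {b n : ℕ} {A : DFA (Fin b) (Fin n)} {m : ℕ → ℕ} {q : ℕ} {e : MemTerm} {x : Fin n}

theorem eval_digit (h : StoresDFA A m) (a : Fin b) (he : e.eval m n q = x) :
    (digit a e).eval m n q = A.step x a := by
  rw [digit, eval, he, zero_mul, add_zero, h.step]

open Classical in
theorem eval_flag (h : StoresDFA A m) (he : e.eval m n q = x) :
    (flag b e).eval m n q = if x ∈ A.accept then 1 else 0 := by
  rw [flag, eval, he, one_mul, h.accept]

theorem eval_preimage (h : StoresDFA A m) (a : Fin b) (he : e.eval m n q = x) :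
    (preimage a e).eval m n q = h.table a x := by
  rw [preimage, eval, he, one_mul, StoresDFA.table]

end Eval

end MemTerm

open MemTerm in
/-- The equations between memory terms that express `PascalRelationsAt` at the loop counter. -/
def pascalEquations (b : ℕ) : List (MemTerm × MemTerm) :=
  let zero := digit (0 : Fin (b + 2))
  let one := digit (1 : Fin (b + 2))
  let g e := preimage (0 : Fin (b + 2)) (one e)
  (preimage (0 : Fin (b + 2)) (zero counter), counter) ::
  (preimage (1 : Fin (b + 2)) (one counter), counter) ::
  (g (zero counter), digit (Fin.last (b + 1)) (g counter)) ::
  (flag (b + 2) (zero counter), flag (b + 2) counter) ::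
  (List.finRange (b + 1)).map fun a => (digit a.succ counter, digit a.castSucc (g counter))

theorem forall_pascalEquations_iff_pascalRelationsAt {b n : ℕ} {A : DFA (Fin (b + 2)) (Fin n)}
    {m : ℕ → ℕ} (h : StoresDFA A m) (q : Fin n) :
    (∀ e ∈ pascalEquations b, e.1.eval m n q = e.2.eval m n q) ↔
      PascalRelationsAt A (h.table 0) (h.table 1) q := by
  have hq : MemTerm.counter.eval m n q = q := rfl
  have hstep (a) := MemTerm.eval_digit h a hq
  have hg := MemTerm.eval_preimage h 0 (hstep 1)
  have hg_zero := MemTerm.eval_preimage h 0 (MemTerm.eval_digit h 1 (hstep 0))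
  have hstep_g (a) := MemTerm.eval_digit h a hg
  simp only [pascalEquations, List.forall_mem_cons, List.forall_mem_map, List.mem_finRange,
    forall_const, hq, hstep, hstep_g, hg_zero, MemTerm.eval_preimage h _ (hstep _),
    MemTerm.eval_flag h hq, MemTerm.eval_flag h (hstep 0), Fin.val_inj]
  classical
  have hflag : ((if A.step q 0 ∈ A.accept then 1 else 0) = if q ∈ A.accept then 1 else 0) ↔
      (A.step q 0 ∈ A.accept ↔ q ∈ A.accept) := by
    split_ifs <;> simp [*]
  rw [hflag]
  exact ⟨fun ⟨h₁, h₂, h₃, h₄, h₅⟩ => ⟨h₁, h₂, h₅, h₃, h₄⟩,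
    fun ⟨h₁, h₂, h₅, h₃, h₄⟩ => ⟨h₁, h₂, h₃, h₄, h₅⟩⟩

theorem IsMinimalDFA.forall_pascalRelationsAt_iff {b : ℕ} {α : Type*} [Finite α]
    {A : DFA (Fin (b + 2)) α} (hA : IsMinimalDFA A) {pre₀ pre₁ : α → α}
    (hpre₀ : Function.Injective (A.step · 0) → Function.LeftInverse pre₀ (A.step · 0))
    (hpre₁ : Function.Injective (A.step · 1) → Function.LeftInverse pre₁ (A.step · 1)) :
    (∀ q, PascalRelationsAt A pre₀ pre₁ q) ↔ IsPascalQuotient A := by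
  refine ⟨fun h => ?_, fun h q => ?_⟩
  · obtain ⟨g, d, hgd⟩ := exists_isPascalPresentation_of_pascalRelationsAt h
    exact hgd.isPascalQuotient hA
  · obtain ⟨g, d, hgd⟩ := h.exists_isPascalPresentation
    exact hgd.pascalRelationsAt hpre₀ hpre₁ q

theorem IsMinimalDFA.forall_pascalEquations_iff_isPascalQuotient {b n : ℕ}
    {A : DFA (Fin (b + 2)) (Fin n)} (hA : IsMinimalDFA A) {m : ℕ → ℕ} (h : StoresDFA A m) :
    (∀ q < n, ∀ e ∈ pascalEquations b,
      e.1.eval (withPreimages (b + 2) n 1 (withPreimages (b + 2) n 0 m)) n q =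
        e.2.eval (withPreimages (b + 2) n 1 (withPreimages (b + 2) n 0 m)) n q) ↔
      IsPascalQuotient A := by
  have h₁ := h.storesDFA_withPreimages 0
  have h₂ := h₁.storesDFA_withPreimages 1
  have hpre₀ := h.leftInverse_table h₂ (a := 0) fun _ hi => preimageTable_of_lt hi n
  have hpre₁ := h₁.leftInverse_table h₂ (a := 1) fun _ _ => rfl
  simp only [← hA.forall_pascalRelationsAt_iff hpre₀ hpre₁,
    ← forall_pascalEquations_iff_pascalRelationsAt h₂, Fin.forall_iff]

/-- The program that tabulates the preimages under the digit `a`. -/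
def tabulatePreimages {b : ℕ} (a : Fin b) : Program :=
  forLoop (tabulate (b + 1 + a) (.digit a .counter))

/-- A bound for the time in each pass of the loop, and for the addresses as multiples of `n`. -/
def tabulatePreimagesCost {b : ℕ} (a : Fin b) : ℕ :=
  tabulateCost (b + 1 + a) (.digit a .counter)

theorem runsTo_tabulatePreimages {W b n q r : ℕ} {A : DFA (Fin b) (Fin n)} {m : ℕ → ℕ}
    (h : StoresDFA A m) (a : Fin b) (hnW : n ≤ W) (hW : tabulatePreimagesCost a * n ≤ W)
    {σ : Store} (hσ : HasContents n q r m σ) :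
    RunsTo W (tabulatePreimages a) (n * (tabulatePreimagesCost a + 3) + 2) σ
      (HasContents n n r (withPreimages b n a m)) := by
  refine runsTo_forLoop (r := fun _ => r)
    (m := preimageTable m (2 + (b + 1 + a) * n) fun q => m (2 + a + b * q)) hnW
    (fun k hk σ hσ => ?_) hσ
  have hk_stores := h.storesDFA_preimageTable (encodeDFA_end_le_table_start b n a)
    (fun q => m (2 + a + b * q)) hk.le
  have := runsTo_tabulate hk_stores.le hk (.digit a .counter) hW hσ
  rwa [MemTerm.eval_digit (x := ⟨k, hk⟩) hk_stores a rfl, ← h.step] at this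

/-- The decision procedure for quotients of Pascal automata in base `b + 2`. -/
def pascalProgram (b : ℕ) : Program :=
  .seq (.load 1 0) (.seq (.const 0 1) (.seq (tabulatePreimages (0 : Fin (b + 2)))
    (.seq (tabulatePreimages (1 : Fin (b + 2))) (forLoop (checkAll (pascalEquations b))))))

/-- A bound for the time and for the addresses, as multiples of the number of states. -/
def pascalCost (b : ℕ) : ℕ :=
  tabulatePreimagesCost (0 : Fin (b + 2)) + tabulatePreimagesCost (1 : Fin (b + 2)) +
    checkCost (pascalEquations b) + 17

open Classical in
theorem runsTo_pascalProgram {b n : ℕ} {A : DFA (Fin (b + 2)) (Fin n)} (hA : IsMinimalDFA A) :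
    RunsTo (pascalCost b * n) (pascalProgram b) (pascalCost b * n) (inputStore A)
      fun σ => σ.reg 0 = if IsPascalQuotient A then 1 else 0 := by
  have hn : 0 < n := A.start.pos
  have h₀ := storesDFA_inputStore A
  have h₁ := h₀.storesDFA_withPreimages 0
  have h₂ := h₁.storesDFA_withPreimages 1
  have hcost : pascalCost b * n = tabulatePreimagesCost (0 : Fin (b + 2)) * n +
      tabulatePreimagesCost (1 : Fin (b + 2)) * n + checkCost (pascalEquations b) * n + 17 * n := by
    simp only [pascalCost, add_mul]
  have hload := Exec.load (W := pascalCost b * n) (inputStore A) 1 0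
  have hsize : HasContents n 0 0 (inputStore A).mem
      ((inputStore A).setReg 1 ((inputStore A).mem 0)) :=
    ⟨rfl, inputStore_mem_zero A, rfl, rfl⟩
  have hrun := (RunsTo.of_exec hload le_rfl hsize).seq fun _ hσ =>
    (RunsTo.of_exec (.const _ 0 1 (by omega)) le_rfl (hσ.setAnswer 1)).seq fun _ hσ =>
    (runsTo_tabulatePreimages h₀ 0 (by omega) (by omega) hσ).seq fun _ hσ =>
    (runsTo_tabulatePreimages h₁ 1 (by omega) (by omega) hσ).seq fun _ hσ =>
    runsTo_forLoop_checkAll h₂.le (by omega) (pascalEquations b) (by omega) hσ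
  refine hrun.mono ?_ fun σ hσ => hσ.answer.trans
    (if_congr (hA.forall_pascalEquations_iff_isPascalQuotient h₀) rfl rfl)
  rw [hcost]
  linarith

/-- For every base `b`, one program decides in linear time, on words of logarithmic length, whether
a minimal DFA over the digits of base `b` is a quotient of a Pascal automaton. The answer is left in
register `0`. -/
theorem mainTheorem5 (b : ℕ) (hb : 2 ≤ b) :
    ∃ (P : Program) (C : ℕ), ∀ (n : ℕ) (A : DFA (Fin b) (Fin n)), IsMinimalDFA A →
      ∃ (t : ℕ) (σ : Store), t ≤ C * n ∧ Exec (C * n) P (inputStore A) t σ ∧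
        (IsPascalQuotient A → σ.reg 0 = 1) ∧ (¬ IsPascalQuotient A → σ.reg 0 = 0) := by
  classical
  obtain ⟨b, rfl⟩ := Nat.exists_eq_add_of_le' hb
  refine ⟨pascalProgram b, pascalCost b, fun n A hA => ?_⟩
  obtain ⟨t, ht, σ, hexec, hσ⟩ := runsTo_pascalProgram hA
  exact ⟨t, σ, ht, hexec, fun h => hσ.trans (if_pos h), fun h => hσ.trans (if_neg h)⟩
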